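/- Let $\mathbb F$ be $\mathbb R$ or $\mathbb C$ (or, more generally, any complete separable normed field with its Borel $\sigma$-algebra), and let $I(\cdot\,;\cdot)$ denote mutual information in nats (possibly $+\infty$). A nested coset coding scheme $(G^{\mathrm{enc}},G^{\mathrm{sec}})$ over $\mathbb F$ consists of matrices $G^{\mathrm{enc}}\in\mathbb F^{m\times n}$ and $G^{\mathrm{sec}}\in\mathbb F^{k\times n}$ of full row rank whose row spaces intersect trivially, together with a probability distribution for the noise vector $r\in\mathbb F^k$. A secret $s\in\mathbb F^m$, independent of $r$, is shared as $\hat s=sG^{\mathrm{enc}}+rG^{\mathrm{sec}}\in\mathbb F^n$. For $\delta\ge 0$ the scheme is $(X,\delta)$-secure if $\frac1m I(s;\hat s_{\mathcal T})\le\delta$ for every $\mathcal T\subseteq[n]$ with $|\mathcal T|=X$ and every distribution of $s$ with $\|s\|_\infty\le 1$ almost surely. A linear SDMM (secure distributed matrix multiplication) scheme with $N$ workers and security parameter $X$ for matrices $A\in\mathbb F^{t\times s}$ and $B\in\mathbb F^{s\times r}$ is given by two nested coset coding schemes $(F^{\mathrm{enc}},F^{\mathrm{sec}})$ and $(G^{\mathrm{enc}},G^{\mathrm{sec}})$,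 where $F^{\mathrm{enc}}\in\mathbb F^{P_A\times N}$, $G^{\mathrm{enc}}\in\mathbb F^{P_B\times N}$ and $F^{\mathrm{sec}},G^{\mathrm{sec}}\in\mathbb F^{X\times N}$, and by partitions of $A$ into blocks $A_1,\dots,A_{P_A}$ of equal size and of $B$ into blocks $B_1,\dots,B_{P_B}$ of equal size, each arranged in a grid. The matrices are encoded as $$(\hat A_1,\dots,\hat A_N)=(A_1,\dots,A_{P_A})F^{\mathrm{enc}}+(R_1,\dots,R_X)F^{\mathrm{sec}},$$ $$(\hat B_1,\dots,\hat B_N)=(B_1,\dots,B_{P_B})G^{\mathrm{enc}}+(S_1,\dots,S_X)G^{\mathrm{sec}}.$$ Here the vectors $(R_1^{\mu,\nu},\dots,R_X^{\mu,\nu})$, for the entry positions $(\mu,\nu)$ of a block, are independent copies of the noise vector of $(F^{\mathrm{enc}},F^{\mathrm{sec}})$; similarly the $S_j$ are formed from independent copies of the noise vector of $(G^{\mathrm{enc}},G^{\mathrm{sec}})$; and $(A,B)$, $(R_j)_j$, $(S_j)_j$ are independent. The scheme is $(X,\delta)$-secure if $$\tfrac1{ts}I(A;\hat A_{\mathcal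 X})\le\delta\quad\text{and}\quad\tfrac1{sr}I(B;\hat B_{\mathcal X})\le\delta$$ for every $\mathcal X\subseteq[N]$ with $|\mathcal X|=X$ and every joint distribution of $(A,B)$ such that almost surely all entries of $A$ and of $B$ have absolute value at most $1$. (For the degenerate case in which the number of input symbols is $0$, the leakage is read as $0$.) **Lemma.** If the secret sharing schemes defined by $(F^{\mathrm{enc}},F^{\mathrm{sec}})$ and $(G^{\mathrm{enc}},G^{\mathrm{sec}})$ are both $(X,\delta)$-secure, then the linear SDMM scheme defined by them is $(X,\delta)$-secure. -/

import Mathlib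

open MeasureTheory
open scoped ENNReal NNReal

noncomputable section

namespace SDMM

/-- Matrices carry the product (entrywise) sigma-algebra. -/
instance matrixMeasurableSpace {m n α : Type*} [MeasurableSpace α] :
    MeasurableSpace (Matrix m n α) :=
  inferInstanceAs (MeasurableSpace (m → n → α))

/-- Mutual information `I(x; y)`, in nats, of two random variables on a probability space:
the Kullback--Leibler divergence of their joint law from the product of their laws
(with value `∞` allowed). -/
def mutualInfo {Ω α β : Type*} [MeasurableSpace Ω] [MeasurableSpace α] [MeasurableSpace β]
    (μ : Measure Ω) (x : Ω → α) (y : Ω → β) : ℝ≥0∞ :=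
  InformationTheory.klDiv (μ.map (fun ω => (x ω, y ω))) ((μ.map x).prod (μ.map y))

/-- A nested coset coding scheme over `𝕜` with `m` secret symbols, `k` noise symbols and `n`
parties, together with the law of its noise vector. The generator matrices have full row rank
and their row spaces intersect trivially. -/
structure NestedCosetScheme (𝕜 : Type*) [NormedField 𝕜] [MeasurableSpace 𝕜] (m k n : ℕ) where
  enc : Matrix (Fin m) (Fin n) 𝕜
  sec : Matrix (Fin k) (Fin n) 𝕜
  enc_fullRank : LinearIndependent 𝕜 (fun i => enc i)
  sec_fullRank : LinearIndependent 𝕜 (fun i => sec i)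
  rowSpaces_disjoint :
    Disjoint (Submodule.span 𝕜 (Set.range fun i => enc i))
      (Submodule.span 𝕜 (Set.range fun i => sec i))
  /-- The law of the noise vector. -/
  noise : Measure (Fin k → 𝕜)
  noise_isProb : IsProbabilityMeasure noise

namespace NestedCosetScheme

variable {𝕜 : Type*} [NormedField 𝕜] [MeasurableSpace 𝕜] {m k n : ℕ}

/-- The vector of shares `s * enc + r * sec`; party `i` gets coordinate `i`. -/
def shares (C : NestedCosetScheme 𝕜 m k n) (s : Fin m → 𝕜) (r : Fin k → 𝕜) : Fin n → 𝕜 :=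
  Matrix.vecMul s C.enc + Matrix.vecMul r C.sec

/-- The average leakage per input symbol `(1/m) I(s; ŝ_T)` when the secret has law `law` and the
noise is independent of it. -/
def leakage (C : NestedCosetScheme 𝕜 m k n) (law : Measure (Fin m → 𝕜)) (T : Finset (Fin n)) :
    ℝ≥0∞ :=
  mutualInfo (law.prod C.noise) (fun ω => ω.1) (fun ω (i : T) => C.shares ω.1 ω.2 i) / (m : ℝ≥0∞)

/-- `(t, δ)`-security. The norm on `Fin m → 𝕜` is the sup norm. -/
def IsSecure (C : NestedCosetScheme 𝕜 m k n) (t : ℕ) (δ : ℝ≥0) : Prop :=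
  ∀ law : Measure (Fin m → 𝕜), IsProbabilityMeasure law → (∀ᵐ s ∂law, ‖s‖ ≤ 1) →
    ∀ T : Finset (Fin n), T.card = t → C.leakage law T ≤ (δ : ℝ≥0∞)

end NestedCosetScheme

/-- A partition of `t × s` matrices into `P` blocks of equal size `blockRows × blockCols`, arranged
in a `gridRows × gridCols` grid and enumerated by `enum`. The case `gridRows = 1` cuts a
matrix into vertical strips, the case `gridCols = 1` into horizontal strips. -/
structure BlockPartition (t s P : ℕ) where
  gridRows : ℕ
  gridCols : ℕ
  blockRows : ℕ
  blockCols : ℕ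
  rows_eq : gridRows * blockRows = t
  cols_eq : gridCols * blockCols = s
  enum : Fin P ≃ Fin gridRows × Fin gridCols

/-- The `j`-th block of `A`. -/
def BlockPartition.block {𝕜 : Type*} {t s P : ℕ} (π : BlockPartition t s P)
    (A : Matrix (Fin t) (Fin s) 𝕜) (j : Fin P) :
    Matrix (Fin π.blockRows) (Fin π.blockCols) 𝕜 :=
  Matrix.of fun μ ν =>
    A (Fin.cast π.rows_eq (finProdFinEquiv ((π.enum j).1, μ)))
      (Fin.cast π.cols_eq (finProdFinEquiv ((π.enum j).2, ν)))

section MatrixSharing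

variable {𝕜 : Type*} [NormedField 𝕜] [MeasurableSpace 𝕜] {t s P k n : ℕ}

/-- Sample space of the noise blocks: an outcome assigns to each entry position `(μ, ν)` of a block
the vector of the `(μ, ν)` entries of the `k` noise blocks. -/
abbrev NoiseSpace (𝕜 : Type*) {t s P : ℕ} (π : BlockPartition t s P) (k : ℕ) : Type _ :=
  Fin π.blockRows × Fin π.blockCols → Fin k → 𝕜

/-- The law of the noise blocks: every entry position uses an independent copy of the noise vector
of the scheme. If the coordinates of that vector are independent, so are all entries of all
noise blocks. -/
def noiseLaw (π : BlockPartition t s P) (C : NestedCosetScheme 𝕜 P k n) :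
    Measure (NoiseSpace 𝕜 π k) :=
  Measure.pi fun _ => C.noise

/-- The `j`-th noise block. -/
def noiseBlock (π : BlockPartition t s P) (R : NoiseSpace 𝕜 π k) (j : Fin k) :
    Matrix (Fin π.blockRows) (Fin π.blockCols) 𝕜 :=
  Matrix.of fun μ ν => R (μ, ν) j

/-- The share `Â_i` in `(Â_1, …, Â_n) = (A_1, …, A_P) * enc + (R_1, …, R_k) * sec`. -/
def matrixShare (π : BlockPartition t s P) (C : NestedCosetScheme 𝕜 P k n)
    (A : Matrix (Fin t) (Fin s) 𝕜) (R : NoiseSpace 𝕜 π k) (i : Fin n) :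
    Matrix (Fin π.blockRows) (Fin π.blockCols) 𝕜 :=
  (∑ j, C.enc j i • π.block A j) + ∑ j, C.sec j i • noiseBlock π R j

end MatrixSharing

/-- A linear SDMM scheme for products of a `t × s` and an `s × r` matrix, with `N` workers and
security parameter `X`: the two matrices are cut into `PA` and `PB` blocks, which are encoded with
the nested coset coding schemes `F` and `G`, each using `X` noise blocks. -/
structure LinearSDMM (𝕜 : Type*) [NormedField 𝕜] [MeasurableSpace 𝕜]
    (t s r PA PB X N : ℕ) where
  partA : BlockPartition t s PA
  partB : BlockPartition s r PB
  F : NestedCosetScheme 𝕜 PA X N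
  G : NestedCosetScheme 𝕜 PB X N

namespace LinearSDMM

variable {𝕜 : Type*} [NormedField 𝕜] [MeasurableSpace 𝕜] {t s r PA PB X N : ℕ}

/-- Everything random in a run of the scheme: the inputs `(A, B)` and the noise blocks `(R, S)`. -/
abbrev Sample (D : LinearSDMM 𝕜 t s r PA PB X N) : Type _ :=
  (Matrix (Fin t) (Fin s) 𝕜 × Matrix (Fin s) (Fin r) 𝕜) ×
    (NoiseSpace 𝕜 D.partA X × NoiseSpace 𝕜 D.partB X)

/-- The inputs have joint law `law`; the noise blocks `R` and `S` are independent of the inputs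
and of each other. -/
def sampleLaw (D : LinearSDMM 𝕜 t s r PA PB X N)
    (law : Measure (Matrix (Fin t) (Fin s) 𝕜 × Matrix (Fin s) (Fin r) 𝕜)) : Measure D.Sample :=
  law.prod ((noiseLaw D.partA D.F).prod (noiseLaw D.partB D.G))

/-- `(1/(ts)) I(A; Â_T)`. -/
def leakageA (D : LinearSDMM 𝕜 t s r PA PB X N)
    (law : Measure (Matrix (Fin t) (Fin s) 𝕜 × Matrix (Fin s) (Fin r) 𝕜))
    (T : Finset (Fin N)) : ℝ≥0∞ :=
  mutualInfo (D.sampleLaw law) (fun ω => ω.1.1)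
    (fun ω (i : T) => matrixShare D.partA D.F ω.1.1 ω.2.1 i) / ((t * s : ℕ) : ℝ≥0∞)

/-- `(1/(sr)) I(B; B̂_T)`. -/
def leakageB (D : LinearSDMM 𝕜 t s r PA PB X N)
    (law : Measure (Matrix (Fin t) (Fin s) 𝕜 × Matrix (Fin s) (Fin r) 𝕜))
    (T : Finset (Fin N)) : ℝ≥0∞ :=
  mutualInfo (D.sampleLaw law) (fun ω => ω.1.2)
    (fun ω (i : T) => matrixShare D.partB D.G ω.1.2 ω.2.2 i) / ((s * r : ℕ) : ℝ≥0∞)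

/-- `(X, δ)`-security of a linear SDMM scheme with security parameter `X`. -/
def IsSecure (D : LinearSDMM 𝕜 t s r PA PB X N) (δ : ℝ≥0) : Prop :=
  ∀ law : Measure (Matrix (Fin t) (Fin s) 𝕜 × Matrix (Fin s) (Fin r) 𝕜),
    IsProbabilityMeasure law →
    (∀ᵐ M ∂law, (∀ i j, ‖M.1 i j‖ ≤ 1) ∧ (∀ i j, ‖M.2 i j‖ ≤ 1)) →
    ∀ T : Finset (Fin N), T.card = X →
      D.leakageA law T ≤ (δ : ℝ≥0∞) ∧ D.leakageB law T ≤ (δ : ℝ≥0∞)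

end LinearSDMM

end SDMM

end

/-! Regroup the entries of a matrix by their position inside a block. Each position carries a vector
of `P` secret symbols, shared with its own independent noise vector, so encoding the matrix means
using one memoryless channel in parallel, once per position (`matrixShare_apply`). For such a
channel, even with dependent inputs, `I(x; y) ≤ ∑ I(x_i; y_i)` (`mutualInfo_parallel_le_sum`).
Scheme security covers every bounded law of the secret, so each position leaks at most `δ * P`, and
positions times `P` equals the number of matrix entries.

The outputs need not have entropies, so subadditivity is proved with divergences: `I(x; y)` is at
most the divergence of the joint law from `P_x ⊗ Q` for every `Q` (`mutualInfo_le_klDiv_prod`). With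
`Q` the product of the output marginals, the joint density factors over the coordinates and the
divergence is exactly the sum. -/

namespace SDMM

open ProbabilityTheory InformationTheory

/-! ### Mutual information: data processing and a variational bound -/

section MutualInfo

variable {Ω Ω' α β α' β' : Type*} [MeasurableSpace Ω] [MeasurableSpace Ω'] [MeasurableSpace α]
  [MeasurableSpace β] [MeasurableSpace α'] [MeasurableSpace β']

theorem mutualInfo_map (μ : Measure Ω) {g : Ω → Ω'} (hg : Measurable g) {x : Ω' → α} {y : Ω' → β}
    (hx : Measurable x) (hy : Measurable y) :
    mutualInfo (μ.map g) x y = mutualInfo μ (fun ω => x (g ω)) (fun ω => y (g ω)) := by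
  unfold mutualInfo
  rw [Measure.map_map hx hg, Measure.map_map hy hg, Measure.map_map (hx.prodMk hy) hg]
  rfl

/-- Data processing: functions of `x` and of `y` share at most the information `x` and `y` share. -/
theorem mutualInfo_comp_le (μ : Measure Ω) [IsProbabilityMeasure μ] {x : Ω → α} {y : Ω → β}
    (hx : Measurable x) (hy : Measurable y) {φ : α → α'} {ψ : β → β'}
    (hφ : Measurable φ) (hψ : Measurable ψ) :
    mutualInfo μ (fun ω => φ (x ω)) (fun ω => ψ (y ω)) ≤ mutualInfo μ x y := by
  have : IsProbabilityMeasure (μ.map x) := Measure.isProbabilityMeasure_map hx.aemeasurable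
  have : IsProbabilityMeasure (μ.map y) := Measure.isProbabilityMeasure_map hy.aemeasurable
  have h := klDiv_map_le (μ.map (fun ω => (x ω, y ω))) ((μ.map x).prod (μ.map y))
    (hφ.prodMap hψ)
  rw [Measure.map_map (hφ.prodMap hψ) (hx.prodMk hy), ← Measure.map_prod_map _ _ hφ hψ,
    Measure.map_map hφ hx, Measure.map_map hψ hy] at h
  exact h

/-- Among the product measures `μ_x ⊗ ρ`, the divergence from the joint law is minimal when `ρ` is
the law of `y`. -/
theorem mutualInfo_le_klDiv_prod [StandardBorelSpace α] [Nonempty α] (μ : Measure Ω)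
    [IsProbabilityMeasure μ] {x : Ω → α} {y : Ω → β} (hx : Measurable x) (hy : Measurable y)
    (ρ : Measure β) [IsProbabilityMeasure ρ] :
    mutualInfo μ x y ≤ klDiv (μ.map (fun ω => (x ω, y ω))) ((μ.map x).prod ρ) := by
  have : IsProbabilityMeasure (μ.map x) := Measure.isProbabilityMeasure_map hx.aemeasurable
  have : IsProbabilityMeasure (μ.map y) := Measure.isProbabilityMeasure_map hy.aemeasurable
  set J := μ.map (fun ω => (x ω, y ω)) with hJ
  set J' := μ.map (fun ω => (y ω, x ω)) with hJ'
  have : IsProbabilityMeasure J := Measure.isProbabilityMeasure_map (hx.prodMk hy).aemeasurable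
  have : IsProbabilityMeasure J' := Measure.isProbabilityMeasure_map (hy.prodMk hx).aemeasurable
  have hswap : J.map Prod.swap = J' := Measure.map_map measurable_swap (hx.prodMk hy)
  have hswap' : J'.map Prod.swap = J := Measure.map_map measurable_swap (hy.prodMk hx)
  have hfst : J'.fst = μ.map y := Measure.fst_map_prodMk hx
  have h₁ : klDiv J ((μ.map x).prod (μ.map y)) ≤ klDiv J' ((μ.map y).prod (μ.map x)) := by
    rw [← hswap', ← Measure.prod_swap]
    exact klDiv_map_le _ _ measurable_swap
  have h₂ : klDiv J' (ρ.prod (μ.map x)) ≤ klDiv J ((μ.map x).prod ρ) := by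
    rw [← hswap, ← Measure.prod_swap]
    exact klDiv_map_le _ _ measurable_swap
  -- Chain rule: the divergence of `J'` from `ρ ⊗ μ_x` is `klDiv μ_y ρ` plus the mutual information.
  -- The swap puts `y` first so that only `α` has to be standard Borel for the disintegration.
  have h₃ := klDiv_compProd_eq_add J'.fst ρ J'.condKernel (Kernel.const β (μ.map x))
  rw [J'.disintegrate, hfst, Measure.compProd_const, Measure.compProd_const] at h₃
  exact h₁.trans (le_trans (h₃ ▸ le_add_self) h₂)

end MutualInfo

/-! ### Densities of composition products and of finite products -/

section Density

variable {α β : Type*} [MeasurableSpace α] [MeasurableSpace β]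

theorem compProd_eq_withDensity (ν : Measure α) [SFinite ν] (K : Kernel α β) [IsSFiniteKernel K]
    (Q : Measure β) [SFinite Q] {G : α × β → ℝ≥0∞} (hG : Measurable G)
    (h : ∀ᵐ x ∂ν, K x = Q.withDensity (fun y => G (x, y))) :
    ν.compProd K = (ν.prod Q).withDensity G := by
  ext S hS
  rw [Measure.compProd_apply hS, withDensity_apply _ hS, ← lintegral_indicator hS,
    lintegral_prod _ (hG.indicator hS).aemeasurable]
  refine lintegral_congr_ae ?_
  filter_upwards [h] with x hx
  have hSx : MeasurableSet (Prod.mk x ⁻¹' S) := measurable_prodMk_left hS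
  rw [hx, withDensity_apply _ hSx, ← lintegral_indicator hSx]
  rfl

theorem llr_withDensity_ae_eq (Q : Measure α) [SigmaFinite Q] {F : α → ℝ≥0∞} (hF : Measurable F) :
    llr (Q.withDensity F) Q =ᵐ[Q.withDensity F] fun x => Real.log (F x).toReal := by
  filter_upwards [(withDensity_absolutelyContinuous Q F).ae_le (Q.rnDeriv_withDensity hF)] with x hx
  rw [llr, hx]

/-- Points where the density vanishes have no mass under the new measure; this lets the logarithm of
a product of densities split. -/
theorem ae_withDensity_pos_lt_top (Q : Measure α) [SigmaFinite Q] {F : α → ℝ≥0∞}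
    (hF : Measurable F) [IsFiniteMeasure (Q.withDensity F)] :
    ∀ᵐ x ∂(Q.withDensity F), 0 < F x ∧ F x < ∞ := by
  have hac := withDensity_absolutelyContinuous Q F
  filter_upwards [hac.ae_le (Q.rnDeriv_withDensity hF), Measure.rnDeriv_pos hac,
    hac.ae_le (Measure.rnDeriv_lt_top (Q.withDensity F) Q)] with x h₁ h₂ h₃
  rw [h₁] at h₂ h₃
  exact ⟨h₂, h₃⟩

variable {ι : Type*} [Fintype ι]

theorem lintegral_pi_prod (q : ι → Measure β) [∀ i, IsProbabilityMeasure (q i)]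
    {g : ι → β → ℝ≥0∞} (hg : ∀ i, Measurable (g i)) :
    ∫⁻ y, ∏ i, g i (y i) ∂(Measure.pi q) = ∏ i, ∫⁻ b, g i b ∂(q i) := by
  rw [lintegral_prod_eq_prod_lintegral_of_indepFun Finset.univ (fun i (y : ι → β) => g i (y i))
    (iIndepFun_pi fun i => (hg i).aemeasurable) (fun i => (hg i).comp (measurable_pi_apply i))]
  refine Finset.prod_congr rfl fun i _ => ?_
  exact (measurePreserving_eval q i).lintegral_comp (hg i)

theorem pi_withDensity (q : ι → Measure β) [∀ i, IsProbabilityMeasure (q i)]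
    {g : ι → β → ℝ≥0∞} (hg : ∀ i, Measurable (g i))
    [∀ i, SigmaFinite ((q i).withDensity (g i))] :
    Measure.pi (fun i => (q i).withDensity (g i)) =
      (Measure.pi q).withDensity (fun y => ∏ i, g i (y i)) := by
  refine Measure.pi_eq fun s hs => ?_
  rw [withDensity_apply _ (MeasurableSet.univ_pi hs),
    ← lintegral_indicator (MeasurableSet.univ_pi hs)]
  have h : (Set.univ.pi s).indicator (fun y : ι → β => ∏ i, g i (y i)) =
      fun y => ∏ i, (s i).indicator (g i) (y i) := by
    funext y
    by_cases hy : y ∈ Set.univ.pi s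
    · rw [Set.indicator_of_mem hy]
      exact Finset.prod_congr rfl fun i _ => (Set.indicator_of_mem (hy i trivial) _).symm
    · rw [Set.indicator_of_notMem hy]
      obtain ⟨i, hi⟩ : ∃ i, y i ∉ s i := by simpa using hy
      exact (Finset.prod_eq_zero (Finset.mem_univ i) (Set.indicator_of_notMem hi _)).symm
  rw [h, lintegral_pi_prod q fun i => (hg i).indicator (hs i)]
  exact Finset.prod_congr rfl fun i _ => by
    rw [withDensity_apply _ (hs i), lintegral_indicator (hs i)]

end Density

/-! ### Memoryless channels and subadditivity -/

section Channel

variable {α β γ : Type*} [MeasurableSpace α] [MeasurableSpace β] [MeasurableSpace γ]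

/-- The channel that sends `a` to the law of `f (a, r)`, where `r` has law `ρ`. -/
noncomputable def channel (ρ : Measure γ) [SFinite ρ] (f : α × γ → β) : Kernel α β :=
  (Kernel.id ×ₖ Kernel.const α ρ).map f

theorem channel_apply (ρ : Measure γ) [SFinite ρ] {f : α × γ → β} (hf : Measurable f) (a : α) :
    channel ρ f a = ρ.map (fun r => f (a, r)) := by
  rw [channel, Kernel.map_apply _ hf, Kernel.prod_apply, Kernel.id_apply, Kernel.const_apply,
    Measure.dirac_prod, Measure.map_map hf measurable_prodMk_left]
  rfl

theorem isMarkovKernel_channel (ρ : Measure γ) [IsProbabilityMeasure ρ] {f : α × γ → β}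
    (hf : Measurable f) : IsMarkovKernel (channel ρ f) := by
  unfold channel
  exact Kernel.IsMarkovKernel.map _ hf

theorem map_prod_eq_compProd_channel (ν : Measure α) [SFinite ν] (ρ : Measure γ)
    [IsProbabilityMeasure ρ] {f : α × γ → β} (hf : Measurable f) :
    (ν.prod ρ).map (fun ω => (ω.1, f ω)) = ν.compProd (channel ρ f) := by
  have := isMarkovKernel_channel ρ hf
  ext S hS
  have hm : Measurable (fun ω : α × γ => (ω.1, f ω)) := measurable_fst.prodMk hf
  rw [Measure.map_apply hm hS, Measure.prod_apply (hm hS), Measure.compProd_apply hS]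
  refine lintegral_congr fun a => ?_
  have hfa : Measurable (fun r => f (a, r)) := hf.comp measurable_prodMk_left
  rw [channel_apply ρ hf, Measure.map_apply hfa (measurable_prodMk_left hS)]
  rfl

variable {ι : Type*}

theorem measurable_parallel {f : α × γ → β} (hf : Measurable f) :
    Measurable (fun (ω : (ι → α) × (ι → γ)) i => f (ω.1 i, ω.2 i)) := by
  fun_prop

variable [Fintype ι]

/-- If the channel is used once per coordinate, with independent noise, then the information that
the outputs carry about the inputs is at most the sum over the coordinates. -/
theorem mutualInfo_parallel_le_sum [StandardBorelSpace α] [Nonempty α]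
    [MeasurableSpace.CountablyGenerated β]
    (ν : Measure (ι → α)) [IsProbabilityMeasure ν] (ρ : Measure γ) [IsProbabilityMeasure ρ]
    {f : α × γ → β} (hf : Measurable f) :
    mutualInfo (ν.prod (Measure.pi fun _ : ι => ρ)) (fun ω => ω.1)
        (fun ω i => f (ω.1 i, ω.2 i)) ≤
      ∑ i, mutualInfo ((ν.map fun x => x i).prod ρ) (fun ω => ω.1) f := by
  classical
  -- An infinite summand makes the bound trivial. Otherwise finiteness supplies absolute continuity
  -- and integrable log-likelihood ratios.
  by_cases htop : ∀ i, mutualInfo ((ν.map fun x => x i).prod ρ) (fun ω => ω.1) f ≠ ∞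
  swap
  · push Not at htop
    obtain ⟨i, hi⟩ := htop
    rw [ENNReal.sum_eq_top.2 ⟨i, Finset.mem_univ i, hi⟩]
    exact le_top
  have hfp := measurable_parallel (ι := ι) hf
  set fp : (ι → α) × (ι → γ) → ι → β := fun ω i => f (ω.1 i, ω.2 i) with hfp_def
  set κ := channel ρ f with hκ
  have hκm : IsMarkovKernel κ := isMarkovKernel_channel ρ hf
  set p : ι → Measure α := fun i => ν.map fun x => x i with hp
  have hpp : ∀ i, IsProbabilityMeasure (p i) := fun i =>
    Measure.isProbabilityMeasure_map (measurable_pi_apply i).aemeasurable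
  set q : ι → Measure β := fun i => ((p i).prod ρ).map f with hq
  have hqp : ∀ i, IsProbabilityMeasure (q i) := fun i =>
    Measure.isProbabilityMeasure_map hf.aemeasurable
  have hmi : ∀ i, mutualInfo ((p i).prod ρ) (fun ω => ω.1) f =
      klDiv ((p i).compProd κ) ((p i).prod (q i)) := fun i => by
    rw [mutualInfo, map_prod_eq_compProd_channel _ _ hf]
    congr 2
    exact Measure.fst_prod
  -- the densities of the single uses of the channel
  set F : ι → α × β → ℝ≥0∞ := fun i z => Kernel.rnDeriv κ (Kernel.const α (q i)) z.1 z.2 with hF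
  have hFm : ∀ i, Measurable (F i) := fun i => Kernel.measurable_rnDeriv _ _
  -- Absolute continuity of the joint law passes to almost every fibre; the kernel derivative gives
  -- a jointly measurable version of the fibre densities.
  have hκF : ∀ i, ∀ᵐ a ∂(p i), κ a = (q i).withDensity (fun b => F i (a, b)) := fun i => by
    have hac : (p i).compProd κ ≪ (p i).compProd (Kernel.const α (q i)) := by
      rw [Measure.compProd_const]
      exact (klDiv_ne_top_iff.1 (hmi i ▸ htop i)).1
    filter_upwards [hac.kernel_of_compProd] with a ha
    have h := Measure.withDensity_rnDeriv_eq _ _ ha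
    rw [Kernel.const_apply] at h
    conv_lhs => rw [← h]
    refine withDensity_congr_ae ?_
    have h' := Kernel.rnDeriv_eq_rnDeriv_measure (κ := κ) (η := Kernel.const α (q i)) (a := a)
    rw [Kernel.const_apply] at h'
    exact h'.symm
  have hP : ∀ i, (p i).compProd κ = ((p i).prod (q i)).withDensity (F i) := fun i =>
    compProd_eq_withDensity _ _ _ (hFm i) (hκF i)
  -- the density of the joint law
  set K := channel (Measure.pi fun _ : ι => ρ) fp with hK
  have hKm : IsMarkovKernel K := isMarkovKernel_channel _ hfp
  have hKx : ∀ x, K x = Measure.pi fun i => κ (x i) := fun x => by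
    rw [hK, channel_apply _ hfp]
    simp only [hκ, channel_apply _ hf]
    have hpr : ∀ i, IsProbabilityMeasure (ρ.map fun r => f (x i, r)) := fun i =>
      Measure.isProbabilityMeasure_map (hf.comp measurable_prodMk_left).aemeasurable
    exact Measure.pi_map_pi (f := fun i r => f (x i, r))
      fun i => (hf.comp measurable_prodMk_left).aemeasurable
  set G : (ι → α) × (ι → β) → ℝ≥0∞ := fun z => ∏ i, F i (z.1 i, z.2 i) with hG
  have hGm : Measurable G := Finset.measurable_fun_prod _ fun i _ =>
    (hFm i).comp (by fun_prop)
  have hKG : ∀ᵐ x ∂ν, K x = (Measure.pi q).withDensity (fun y => G (x, y)) := by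
    have h : ∀ᵐ x ∂ν, ∀ i, κ (x i) = (q i).withDensity (fun b => F i (x i, b)) :=
      -- Each exceptional set depends on one coordinate only, so dependence between the inputs is
      -- harmless.
      ae_all_iff.2 fun i => ae_of_ae_map (measurable_pi_apply i).aemeasurable (hκF i)
    filter_upwards [h] with x hx
    have hs : ∀ i, SigmaFinite ((q i).withDensity (fun b => F i (x i, b))) := fun i => by
      rw [← hx i]; infer_instance
    rw [hKx, ← pi_withDensity q (g := fun i b => F i (x i, b))
      fun i => (hFm i).comp measurable_prodMk_left]
    exact congrArg Measure.pi (funext hx)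
  have hJ : ν.compProd K = (ν.prod (Measure.pi q)).withDensity G :=
    compProd_eq_withDensity _ _ _ hGm hKG
  have hproj : ∀ i, MeasurePreserving (fun z : (ι → α) × (ι → β) => (z.1 i, z.2 i))
      (ν.compProd K) ((p i).compProd κ) := fun i => by
    refine ⟨by fun_prop, ?_⟩
    rw [hK, hκ, ← map_prod_eq_compProd_channel _ _ hfp, ← map_prod_eq_compProd_channel _ _ hf,
      Measure.map_map (by fun_prop) (measurable_fst.prodMk hfp)]
    have hm : (p i).prod ρ = (ν.prod (Measure.pi fun _ : ι => ρ)).map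
        (Prod.map (fun x => x i) (fun r => r i)) := by
      rw [← Measure.map_prod_map _ _ (measurable_pi_apply i) (measurable_pi_apply i),
        (measurePreserving_eval (fun _ : ι => ρ) i).map_eq]
    rw [hm, Measure.map_map (measurable_fst.prodMk hf) (by fun_prop)]
    rfl
  -- the log-likelihood ratio of the joint law is the sum of those of the single uses
  have hllr_one : ∀ i, llr ((p i).compProd κ) ((p i).prod (q i)) =ᵐ[(p i).compProd κ]
      fun z => Real.log (F i z).toReal := fun i => by
    rw [hP i]; exact llr_withDensity_ae_eq _ (hFm i)
  have hint_one : ∀ i, Integrable (fun z => Real.log (F i z).toReal) ((p i).compProd κ) :=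
    fun i => (klDiv_ne_top_iff.1 (hmi i ▸ htop i)).2.congr (hllr_one i)
  have hpos : ∀ᵐ z ∂(ν.compProd K), ∀ i, 0 < F i (z.1 i, z.2 i) ∧ F i (z.1 i, z.2 i) < ∞ := by
    refine ae_all_iff.2 fun i => (hproj i).quasiMeasurePreserving.ae (p := fun z =>
      0 < F i z ∧ F i z < ∞) ?_
    have hfin : IsFiniteMeasure (((p i).prod (q i)).withDensity (F i)) := by
      rw [← hP i]; infer_instance
    rw [hP i]
    exact ae_withDensity_pos_lt_top _ (hFm i)
  have hllr : llr (ν.compProd K) (ν.prod (Measure.pi q)) =ᵐ[ν.compProd K]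
      fun z => ∑ i, Real.log (F i (z.1 i, z.2 i)).toReal := by
    have h : llr (ν.compProd K) (ν.prod (Measure.pi q)) =ᵐ[ν.compProd K]
        fun z => Real.log (G z).toReal := by
      rw [hJ]; exact llr_withDensity_ae_eq _ hGm
    filter_upwards [h, hpos] with z hz hz'
    rw [hz, hG, ENNReal.toReal_prod, Real.log_prod]
    exact fun i _ => (ENNReal.toReal_pos (hz' i).1.ne' (hz' i).2.ne).ne'
  have hint : ∀ i, Integrable (fun z : (ι → α) × (ι → β) =>
      Real.log (F i (z.1 i, z.2 i)).toReal) (ν.compProd K) := fun i =>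
    (hproj i).integrable_comp_of_integrable (hint_one i)
  have hac : ν.compProd K ≪ ν.prod (Measure.pi q) := hJ ▸ withDensity_absolutelyContinuous _ _
  have hval : klDiv (ν.compProd K) (ν.prod (Measure.pi q)) =
      ∑ i, klDiv ((p i).compProd κ) ((p i).prod (q i)) := by
    have hfin : klDiv (ν.compProd K) (ν.prod (Measure.pi q)) ≠ ∞ :=
      klDiv_ne_top hac ((integrable_finsetSum _ fun i _ => hint i).congr hllr.symm)
    -- All measures are probabilities, so each divergence is the plain integral of its
    -- log-likelihood ratio, and `hproj` reduces each summand to one coordinate.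
    rw [← ENNReal.toReal_eq_toReal_iff' hfin (ENNReal.sum_ne_top.2 fun i _ => hmi i ▸ htop i),
      ENNReal.toReal_sum fun i _ => hmi i ▸ htop i, toReal_klDiv_of_measure_eq hac (by simp),
      integral_congr_ae hllr, integral_finsetSum _ fun i _ => hint i]
    refine Finset.sum_congr rfl fun i _ => ?_
    rw [toReal_klDiv_of_measure_eq (klDiv_ne_top_iff.1 (hmi i ▸ htop i)).1 (by simp),
      integral_congr_ae (hllr_one i), ← (hproj i).map_eq,
      integral_map (hproj i).measurable.aemeasurable]
    rw [(hproj i).map_eq]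
    exact (hint_one i).aestronglyMeasurable
  refine (mutualInfo_le_klDiv_prod _ measurable_fst hfp (Measure.pi q)).trans (le_of_eq ?_)
  rw [map_prod_eq_compProd_channel _ _ hfp, ← Measure.fst, Measure.fst_prod]
  exact hval.trans (Finset.sum_congr rfl fun i _ => (hmi i).symm)

end Channel

end SDMM

namespace SDMM

/-! ### Sorting matrix entries by position in the block -/

namespace BlockPartition

variable {𝕜 : Type*} {t s P : ℕ} (π : BlockPartition t s P)

/-- The entries of `A`, sorted by their position inside the blocks. -/
def entries (A : Matrix (Fin t) (Fin s) 𝕜) :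
    Fin π.blockRows × Fin π.blockCols → Fin P → 𝕜 :=
  fun a j => π.block A j a.1 a.2

/-- The matrix with given entries inside the blocks. -/
def ofEntries (x : Fin π.blockRows × Fin π.blockCols → Fin P → 𝕜) :
    Matrix (Fin t) (Fin s) 𝕜 :=
  fun i j =>
    x ((finProdFinEquiv.symm (Fin.cast π.rows_eq.symm i)).2,
        (finProdFinEquiv.symm (Fin.cast π.cols_eq.symm j)).2)
      (π.enum.symm ((finProdFinEquiv.symm (Fin.cast π.rows_eq.symm i)).1,
        (finProdFinEquiv.symm (Fin.cast π.cols_eq.symm j)).1))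

theorem ofEntries_entries (A : Matrix (Fin t) (Fin s) 𝕜) : π.ofEntries (π.entries A) = A := by
  funext i j
  simp only [ofEntries, entries, block, Matrix.of_apply, Equiv.apply_symm_apply, Prod.mk.eta]
  rfl

theorem card_positions_mul : π.blockRows * π.blockCols * P = t * s := by
  have h : P = π.gridRows * π.gridCols := by simpa using Fintype.card_congr π.enum
  calc π.blockRows * π.blockCols * P
      = π.blockRows * π.blockCols * (π.gridRows * π.gridCols) := congrArg _ h
    _ = π.gridRows * π.blockRows * (π.gridCols * π.blockCols) := by ring
    _ = t * s := by rw [π.rows_eq, π.cols_eq]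

variable [MeasurableSpace 𝕜]

theorem measurable_matrix_apply {m n : Type*} (i : m) (j : n) :
    Measurable (fun A : Matrix m n 𝕜 => A i j) :=
  (measurable_pi_apply j).comp (measurable_pi_apply (X := fun _ : m => n → 𝕜) i)

theorem measurable_entries : Measurable (π.entries (𝕜 := 𝕜)) :=
  measurable_pi_lambda _ fun _ => measurable_pi_lambda _ fun _ => measurable_matrix_apply _ _

theorem measurable_ofEntries : Measurable (π.ofEntries (𝕜 := 𝕜)) :=
  measurable_pi_lambda (δ := Fin t) (X := fun _ => Fin s → 𝕜) _ fun _ =>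
    measurable_pi_lambda _ fun _ => (measurable_pi_apply _).comp (measurable_pi_apply _)

end BlockPartition

/-! ### Leakage of one shared matrix -/

section Sharing

variable {𝕜 : Type*} [NormedField 𝕜] [MeasurableSpace 𝕜] {t s P k n : ℕ}

theorem matrixShare_apply (π : BlockPartition t s P) (C : NestedCosetScheme 𝕜 P k n)
    (A : Matrix (Fin t) (Fin s) 𝕜) (R : NoiseSpace 𝕜 π k) (i : Fin n)
    (μ : Fin π.blockRows) (ν : Fin π.blockCols) :
    matrixShare π C A R i μ ν = C.shares (π.entries A (μ, ν)) (R (μ, ν)) i := by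
  simp only [matrixShare, NestedCosetScheme.shares, BlockPartition.entries, noiseBlock,
    Matrix.add_apply, Matrix.sum_apply, Matrix.smul_apply, Matrix.of_apply, smul_eq_mul,
    Pi.add_apply, Matrix.vecMul, dotProduct]
  congr 1 <;> exact Finset.sum_congr rfl fun _ _ => mul_comm _ _

variable [SecondCountableTopology 𝕜] [BorelSpace 𝕜]

theorem NestedCosetScheme.measurable_shares (C : NestedCosetScheme 𝕜 P k n) (T : Finset (Fin n)) :
    Measurable (fun (ω : (Fin P → 𝕜) × (Fin k → 𝕜)) (i : T) => C.shares ω.1 ω.2 i) := by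
  simp only [NestedCosetScheme.shares, Pi.add_apply, Matrix.vecMul, dotProduct]
  fun_prop

theorem measurable_matrixShare (π : BlockPartition t s P) (C : NestedCosetScheme 𝕜 P k n)
    (T : Finset (Fin n)) :
    Measurable (fun (ω : Matrix (Fin t) (Fin s) 𝕜 × NoiseSpace 𝕜 π k) (i : T) =>
      matrixShare π C ω.1 ω.2 i) := by
  refine measurable_pi_lambda _ fun i =>
    measurable_pi_lambda (δ := Fin π.blockRows) (X := fun _ => Fin π.blockCols → 𝕜) _ fun a =>
      measurable_pi_lambda _ fun b => ?_
  simp only [matrixShare_apply, NestedCosetScheme.shares, Pi.add_apply, Matrix.vecMul, dotProduct]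
  have h := π.measurable_entries (𝕜 := 𝕜)
  fun_prop

variable [CompleteSpace 𝕜]

/-- Subadditivity over the entry positions plus the scheme's bound at each. Completeness makes the
secret space standard Borel. -/
theorem NestedCosetScheme.IsSecure.mutualInfo_matrixShare_le {C : NestedCosetScheme 𝕜 P k n}
    {X : ℕ} {δ : ℝ≥0} (hC : C.IsSecure X δ) (π : BlockPartition t s P)
    (law : Measure (Matrix (Fin t) (Fin s) 𝕜)) [IsProbabilityMeasure law]
    (hlaw : ∀ᵐ A ∂law, ∀ i j, ‖A i j‖ ≤ 1) {T : Finset (Fin n)} (hT : T.card = X) :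
    mutualInfo (law.prod (noiseLaw π C)) (fun ω => ω.1)
      (fun ω (i : T) => matrixShare π C ω.1 ω.2 i) ≤ δ * ((t * s : ℕ) : ℝ≥0∞) := by
  have hnoise := C.noise_isProb
  have hnoise' : IsProbabilityMeasure (noiseLaw π C) := by unfold noiseLaw; infer_instance
  set ν := law.map π.entries with hν
  have hνp : IsProbabilityMeasure ν :=
    Measure.isProbabilityMeasure_map π.measurable_entries.aemeasurable
  set f : (Fin P → 𝕜) × (Fin k → 𝕜) → T → 𝕜 := fun ω i => C.shares ω.1 ω.2 i with hf
  have hfm : Measurable f := C.measurable_shares T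
  have hfp := measurable_parallel (ι := Fin π.blockRows × Fin π.blockCols) hfm
  -- the matrix and its shares are functions of the entrywise secrets and shares
  have hmap : (law.prod (noiseLaw π C)).map (Prod.map π.entries id) = ν.prod (noiseLaw π C) := by
    rw [← Measure.map_prod_map _ _ π.measurable_entries measurable_id, Measure.map_id]
  have hψ : Measurable (fun (y : Fin π.blockRows × Fin π.blockCols → T → 𝕜) (i : T) =>
      (Matrix.of fun a b => y (a, b) i : Matrix (Fin π.blockRows) (Fin π.blockCols) 𝕜)) :=
    measurable_pi_lambda _ fun i =>
      measurable_pi_lambda (δ := Fin π.blockRows) (X := fun _ => Fin π.blockCols → 𝕜) _ fun a =>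
        measurable_pi_lambda _ fun b => (measurable_pi_apply i).comp (measurable_pi_apply (a, b))
  have h₁ : mutualInfo (law.prod (noiseLaw π C)) (fun ω => ω.1)
      (fun ω (i : T) => matrixShare π C ω.1 ω.2 i) ≤
      mutualInfo (ν.prod (noiseLaw π C)) (fun ω => ω.1) (fun ω a => f (ω.1 a, ω.2 a)) := by
    refine le_trans (le_of_eq ?_) (mutualInfo_comp_le (ν.prod (noiseLaw π C)) measurable_fst hfp
      π.measurable_ofEntries hψ)
    rw [← hmap]
    refine Eq.trans ?_ (mutualInfo_map _ (π.measurable_entries.prodMap measurable_id)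
      (π.measurable_ofEntries.comp measurable_fst) (hψ.comp hfp)).symm
    congr 1
    · funext ω
      exact (π.ofEntries_entries ω.1).symm
    · funext ω i
      ext a b
      exact matrixShare_apply π C ω.1 ω.2 i a b
  -- every entry position is shared securely
  have h₂ : ∀ a, mutualInfo ((ν.map fun x => x a).prod C.noise) (fun ω => ω.1) f ≤
      δ * (P : ℝ≥0∞) := fun a => by
    have hp : IsProbabilityMeasure (ν.map fun x => x a) :=
      Measure.isProbabilityMeasure_map (measurable_pi_apply a).aemeasurable
    have hb : ∀ᵐ x ∂(ν.map fun x => x a), ‖x‖ ≤ 1 := by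
      rw [hν, Measure.map_map (measurable_pi_apply a) π.measurable_entries]
      rw [ae_map_iff ((measurable_pi_apply a).comp π.measurable_entries).aemeasurable
        (measurableSet_le measurable_norm measurable_const)]
      filter_upwards [hlaw] with A hA
      exact (pi_norm_le_iff_of_nonneg zero_le_one).2 fun j => hA _ _
    have h := hC _ hp hb T hT
    -- `P = 0` is covered: as `δ` is finite, a quotient by zero below `δ` has numerator zero.
    rwa [NestedCosetScheme.leakage, ENNReal.div_le_iff_le_mul (Or.inr ENNReal.coe_ne_top)
      (Or.inl (ENNReal.natCast_ne_top P))] at h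
  refine h₁.trans ((mutualInfo_parallel_le_sum ν C.noise hfm).trans
    ((Finset.sum_le_sum fun a _ => h₂ a).trans (le_of_eq ?_)))
  rw [Finset.sum_const, Finset.card_univ, Fintype.card_prod, Fintype.card_fin, Fintype.card_fin,
    nsmul_eq_mul, ← π.card_positions_mul]
  push_cast
  ring

end Sharing

/-! ### Discarding the other matrix and its noise -/

section Marginal

variable {α α' β β' γ δ : Type*} [MeasurableSpace α] [MeasurableSpace α'] [MeasurableSpace β]
  [MeasurableSpace β'] [MeasurableSpace γ] [MeasurableSpace δ]

theorem mutualInfo_prod_marginal (μ : Measure α) [SFinite μ] (ν : Measure β) [SFinite ν]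
    {g : α → α'} (hg : Measurable g) {h : β → β'} (hh : Measurable h)
    {x : α' × β' → γ} (hx : Measurable x) {y : α' × β' → δ} (hy : Measurable y) :
    mutualInfo (μ.prod ν) (fun ω => x (g ω.1, h ω.2)) (fun ω => y (g ω.1, h ω.2)) =
      mutualInfo ((μ.map g).prod (ν.map h)) x y := by
  rw [Measure.map_prod_map _ _ hg hh, mutualInfo_map _ (hg.prodMap hh) hx hy]
  rfl

end Marginal

end SDMM

theorem mainTheorem7 {𝕜 : Type*} [NormedField 𝕜] [CompleteSpace 𝕜] [SecondCountableTopology 𝕜]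
    [MeasurableSpace 𝕜] [BorelSpace 𝕜] {t s r PA PB X N : ℕ}
    (D : SDMM.LinearSDMM 𝕜 t s r PA PB X N) (δ : ℝ≥0)
    (hF : D.F.IsSecure X δ) (hG : D.G.IsSecure X δ) :
    D.IsSecure δ := by
  intro law hlaw hbound T hT
  have hF' := D.F.noise_isProb
  have hG' := D.G.noise_isProb
  have hR : IsProbabilityMeasure (SDMM.noiseLaw D.partA D.F) := by
    unfold SDMM.noiseLaw; infer_instance
  have hS : IsProbabilityMeasure (SDMM.noiseLaw D.partB D.G) := by
    unfold SDMM.noiseLaw; infer_instance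
  constructor
  · have hp : IsProbabilityMeasure (law.map Prod.fst) :=
      Measure.isProbabilityMeasure_map measurable_fst.aemeasurable
    have hb : ∀ᵐ A ∂(law.map Prod.fst), ∀ i j, ‖A i j‖ ≤ 1 := by
      simp only [ae_all_iff]
      intro i j
      rw [ae_map_iff measurable_fst.aemeasurable (measurableSet_le
        (SDMM.BlockPartition.measurable_matrix_apply i j).norm measurable_const)]
      filter_upwards [hbound] with M hM using hM.1 i j
    -- With no input symbols the product bound forces zero information, and `0 / 0 = 0`.
    refine ENNReal.div_le_of_le_mul (le_trans (le_of_eq ?_)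
      (hF.mutualInfo_matrixShare_le D.partA (law.map Prod.fst) hb hT))
    have h := SDMM.mutualInfo_prod_marginal law
      ((SDMM.noiseLaw D.partA D.F).prod (SDMM.noiseLaw D.partB D.G)) measurable_fst measurable_fst
      measurable_fst (SDMM.measurable_matrixShare D.partA D.F T)
    rw [show (Measure.prod (SDMM.noiseLaw D.partA D.F) (SDMM.noiseLaw D.partB D.G)).map Prod.fst = _
      from Measure.fst_prod] at h
    exact h
  · have hp : IsProbabilityMeasure (law.map Prod.snd) :=
      Measure.isProbabilityMeasure_map measurable_snd.aemeasurable
    have hb : ∀ᵐ B ∂(law.map Prod.snd), ∀ i j, ‖B i j‖ ≤ 1 := by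
      simp only [ae_all_iff]
      intro i j
      rw [ae_map_iff measurable_snd.aemeasurable (measurableSet_le
        (SDMM.BlockPartition.measurable_matrix_apply i j).norm measurable_const)]
      filter_upwards [hbound] with M hM using hM.2 i j
    refine ENNReal.div_le_of_le_mul (le_trans (le_of_eq ?_)
      (hG.mutualInfo_matrixShare_le D.partB (law.map Prod.snd) hb hT))
    have h := SDMM.mutualInfo_prod_marginal law
      ((SDMM.noiseLaw D.partA D.F).prod (SDMM.noiseLaw D.partB D.G)) measurable_snd measurable_snd
      measurable_fst (SDMM.measurable_matrixShare D.partB D.G T)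
    rw [show (Measure.prod (SDMM.noiseLaw D.partA D.F) (SDMM.noiseLaw D.partB D.G)).map Prod.snd = _
      from Measure.snd_prod] at h
    exact h
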